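/- Let $\mathbb{K}$ be a field and fix a probability $p\in(0,1)$. For each $n$ let $G$ be a random graph on the vertex set $\{x_1,\ldots,x_n\}$ in which each pair $\{x_i,x_j\}$, $1\le i<j\le n$, is an edge independently with probability $p$. Let $R=\mathbb{K}[x_1,\ldots,x_n]$ and let $I(G)=\langle x_ix_j : \{x_i,x_j\}\in E(G)\rangle$ be the edge ideal of $G$. For a homogeneous ideal $J\subseteq R$ such that $A=R/J$ is artinian, write $A=A_0\oplus A_1\oplus\cdots\oplus A_e$ with $A_e\neq 0$, where $A_i$ is the space of homogeneous elements of degree $i$. Let $\mathrm{soc}(A)=\{a\in A : a\overline{x}_i=0 \text{ for } i=1,\ldots,n\}$. The graded artinian ring $A$ is called level if $\mathrm{soc}(A)_i=0$ for all $i<e$ and $\mathrm{soc}(A)_e\neq 0$. Then for almost all graphs $G$, the graded artinian ring \[R/(I(G)+\langle x_1^{a_1},\ldots,x_n^{a_n}\rangle)\] is not level for any choice of $(a_1,\ldots,a_n)\in\mathbb{N}^n$ with $a_i\ge 2$ for all $i$. That is, the probability that $G$ has the following property tends to $1$ as $n\to\infty$: for every $(a_1,\ldots,a_n)\in\mathbb{N}^n$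 with all $a_i\ge 2$, the ring $R/(I(G)+\langle x_1^{a_1},\ldots,x_n^{a_n}\rangle)$ is a graded artinian ring that is not level. -/

import Mathlib

namespace LevelGraph

open MvPolynomial

attribute [local instance] MvPolynomial.gradedAlgebra

/-- The edge ideal `I(G) = ⟨x_i x_j : {i, j} ∈ E(G)⟩` of a simple graph, in the polynomial ring
over `K` whose variables are the vertices. -/
noncomputable def edgeIdeal (K : Type*) [Field K] {V : Type*} (G : SimpleGraph V) :
    Ideal (MvPolynomial V K) :=
  Ideal.span {f | ∃ i j : V, G.Adj i j ∧ f = X i * X j}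

/-- The ideal `⟨x_i ^ a_i : i ∈ V⟩` generated by the pure powers of the variables. -/
noncomputable def powerIdeal (K : Type*) [Field K] {V : Type*} (a : V → ℕ) : Ideal (MvPolynomial V K) :=
  Ideal.span (Set.range fun i : V => (X i : MvPolynomial V K) ^ a i)

section Level

variable {K : Type*} [Field K] {V : Type*}

/-- `K[V] / J` is a graded artinian `K`-algebra: `J` is homogeneous for the standard grading and the
quotient ring is artinian. -/
def IsGradedArtinian (J : Ideal (MvPolynomial V K)) : Prop :=
  J.IsHomogeneous (homogeneousSubmodule V K) ∧ IsArtinianRing (MvPolynomial V K ⧸ J)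

/-- The degree `d` piece `A_d` of `A = K[V] / J`: the classes of the homogeneous polynomials of
degree `d`. -/
noncomputable def gradedPiece (J : Ideal (MvPolynomial V K)) (d : ℕ) : Submodule K (MvPolynomial V K ⧸ J) :=
  (homogeneousSubmodule V K d).map (Ideal.Quotient.mkₐ K J).toLinearMap

/-- The socle of `A = K[V] / J`: the elements of `A` killed by the class of every variable. -/
noncomputable def socle (J : Ideal (MvPolynomial V K)) : Ideal (MvPolynomial V K ⧸ J) where
  carrier := {b | ∀ i : V, b * Ideal.Quotient.mk J (X i) = 0}
  add_mem' := fun {b c} hb hc i => by rw [add_mul, hb i, hc i, add_zero]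
  zero_mem' := fun i => zero_mul _
  smul_mem' := fun r b hb i => by rw [smul_eq_mul, mul_assoc, hb i, mul_zero]

/-- The entry `s_d = dim_K soc(A)_d` of the socle-vector of `A = K[V] / J`. -/
noncomputable def socleVector (J : Ideal (MvPolynomial V K)) (d : ℕ) : ℕ :=
  Module.finrank K ↥(gradedPiece J d ⊓ (socle J).restrictScalars K)

/-- `e` is the top degree of `A = K[V] / J`, i.e. `A = A_0 ⊕ ⋯ ⊕ A_e` with `A_e ≠ 0`. -/
def IsTopDegree (J : Ideal (MvPolynomial V K)) (e : ℕ) : Prop :=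
  gradedPiece J e ≠ ⊥ ∧ ∀ d, e < d → gradedPiece J d = ⊥

/-- `A = K[V] / J` is a level graded artinian algebra: its socle-vector is `(0, …, 0, s_e)` with
`s_e > 0`, where `e` is the top degree of `A`. -/
def IsLevel (J : Ideal (MvPolynomial V K)) : Prop :=
  IsGradedArtinian J ∧
    ∃ e, IsTopDegree J e ∧ (∀ d, d < e → socleVector J d = 0) ∧ 0 < socleVector J e

end Level

end LevelGraph

namespace LevelGraph

open MvPolynomial

attribute [local instance] MvPolynomial.gradedAlgebra

/-! ### Socle monomials of maximal independent sets -/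

section Algebra

variable {K : Type*} [Field K] {V : Type*}

/-! A maximal independent set `s` of `G` gives a nonzero socle element, the class of `∏ i ∈ s, x_i ^
(a_i - 1)`. If the quotient is level, all maximal independent sets therefore have the same weight
for `w_i = a_i - 1 ≥ 1`.

Suppose `G` has an induced path `0-1-2-3-4` and an independent set `S` with no edge to the path that
dominates every vertex outside both. Then `S` together with any of `{0,2,4}`, `{1,3}`, `{0,3}`,
`{1,4}` is maximal independent. Equal weights force `w_0 = w_1` and `w_3 = w_4`, hence `w_2 = 0`,
which is impossible. This obstruction does not depend on `a` (`not_isLevel_of_induced_path`).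

It remains to find such a configuration with high probability. Put `q = 1 - p` and let `H` be the
path plus `2h - 4` isolated vertices, with `h` about `(3/4) log_{1/q} n`. The copies considered are
transversals of `2h + 1` disjoint blocks, each of size about `n / (2h + 1)`. A second moment
argument shows that induced copies of `H` concentrate. Conditionally on a copy, its isolated part
fails to dominate with probability at most `n q^(2h-4)`. `measureReal_forall_imp_le` combines the
two estimates, and `h` is chosen so that both errors vanish. -/

/-- The exponents of the monomial generators of `I(G) + ⟨x_i ^ a_i⟩`. -/
def generatorExponents (G : SimpleGraph V) (a : V → ℕ) : Set (V →₀ ℕ) :=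
  {d | ∃ i j, G.Adj i j ∧ d = Finsupp.single i 1 + Finsupp.single j 1} ∪
    Set.range fun i => Finsupp.single i (a i)

theorem edgeIdeal_sup_powerIdeal_eq_span (G : SimpleGraph V) (a : V → ℕ) :
    edgeIdeal K G ⊔ powerIdeal K a =
      Ideal.span ((fun d => monomial d (1 : K)) '' generatorExponents G a) := by
  rw [edgeIdeal, powerIdeal, ← Ideal.span_union, generatorExponents, Set.image_union]
  congr 2
  · ext f
    constructor
    · rintro ⟨i, j, h, rfl⟩
      exact ⟨_, ⟨i, j, h, rfl⟩, by simp [X, monomial_mul]⟩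
    · rintro ⟨_, ⟨i, j, h, rfl⟩, rfl⟩
      exact ⟨i, j, h, by simp [X, monomial_mul]⟩
  · rw [← Set.range_comp]
    congr 1
    ext1 i
    simp [X, monomial_pow]

/-- The ideal is monomial, so membership of a monomial means divisibility by a generator. -/
theorem monomial_mem_edgeIdeal_sup_powerIdeal_iff (G : SimpleGraph V) (a : V → ℕ) (d : V →₀ ℕ) :
    monomial d (1 : K) ∈ edgeIdeal K G ⊔ powerIdeal K a ↔
      (∃ i j, G.Adj i j ∧ 1 ≤ d i ∧ 1 ≤ d j) ∨ ∃ i, a i ≤ d i := by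
  classical
  rw [edgeIdeal_sup_powerIdeal_eq_span, mem_ideal_span_monomial_image]
  simp only [support_monomial, one_ne_zero, if_false, Finset.mem_singleton, forall_eq,
    generatorExponents]
  constructor
  · rintro ⟨s, ⟨i, j, h, rfl⟩ | ⟨i, rfl⟩, hle⟩
    · refine Or.inl ⟨i, j, h, ?_, ?_⟩
      · exact le_trans (by simp) (hle i)
      · exact le_trans (by simp) (hle j)
    · exact Or.inr ⟨i, by simpa using hle i⟩
  · rintro (⟨i, j, h, hi, hj⟩ | ⟨i, hi⟩)
    · refine ⟨_, Or.inl ⟨i, j, h, rfl⟩, fun x => ?_⟩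
      have hne := h.ne
      simp only [Finsupp.add_apply, Finsupp.single_apply]
      split_ifs with h1 h2 h2
      · exact absurd (h1.trans h2.symm) hne
      · subst h1; simpa using hi
      · subst h2; simpa using hj
      · simp
    · exact ⟨_, Or.inr ⟨i, rfl⟩, by simpa using hi⟩

theorem isHomogeneous_edgeIdeal_sup_powerIdeal (G : SimpleGraph V) (a : V → ℕ) :
    (edgeIdeal K G ⊔ powerIdeal K a).IsHomogeneous (homogeneousSubmodule V K) := by
  rw [edgeIdeal_sup_powerIdeal_eq_span]
  refine Ideal.homogeneous_span _ _ ?_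
  rintro _ ⟨d, -, rfl⟩
  exact ⟨d.degree, isHomogeneous_monomial _ rfl⟩

/-- The variables become nilpotent, hence integral over `K`, and a finitely generated integral
algebra is a finite module. -/
theorem finite_quotient_of_X_pow_mem [Finite V] {J : Ideal (MvPolynomial V K)} {a : V → ℕ}
    (h : ∀ i, (X i : MvPolynomial V K) ^ a i ∈ J) : Module.Finite K (MvPolynomial V K ⧸ J) := by
  have hint : Algebra.IsIntegral K (MvPolynomial V K ⧸ J) := by
    refine ⟨fun y => ?_⟩
    obtain ⟨f, rfl⟩ := Ideal.Quotient.mk_surjective y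
    induction f using MvPolynomial.induction_on with
    | C r => exact isIntegral_algebraMap (R := K) (A := MvPolynomial V K ⧸ J) (x := r)
    | add f g hf hg => rw [map_add]; exact hf.add hg
    | mul_X f i hf =>
      rw [map_mul]
      refine hf.mul ?_
      -- The exponent is raised by one to stay positive when `a i = 0`.
      refine IsIntegral.of_pow (n := a i + 1) (Nat.succ_pos _) ?_
      rw [← map_pow, pow_succ, Ideal.Quotient.eq_zero_iff_mem.2 (J.mul_mem_right _ (h i))]
      exact isIntegral_zero
  have : Algebra.FiniteType K (MvPolynomial V K ⧸ J) :=
    Algebra.FiniteType.of_surjective (Ideal.Quotient.mkₐ K J) (Ideal.Quotient.mkₐ_surjective K J)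
  exact Algebra.IsIntegral.finite

theorem finite_quotient_edgeIdeal_sup_powerIdeal [Finite V] (G : SimpleGraph V) (a : V → ℕ) :
    Module.Finite K (MvPolynomial V K ⧸ (edgeIdeal K G ⊔ powerIdeal K a)) :=
  finite_quotient_of_X_pow_mem fun i =>
    Ideal.mem_sup_right (Ideal.subset_span (Set.mem_range_self i))

theorem isGradedArtinian_edgeIdeal_sup_powerIdeal [Finite V] (G : SimpleGraph V) (a : V → ℕ) :
    IsGradedArtinian (edgeIdeal K G ⊔ powerIdeal K a) := by
  have := finite_quotient_edgeIdeal_sup_powerIdeal (K := K) G a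
  exact ⟨isHomogeneous_edgeIdeal_sup_powerIdeal G a, IsArtinianRing.of_finite K _⟩

/-- A maximal independent set `s` gives the socle monomial `∏ i ∈ s, x_i ^ (a_i - 1)`, so its weight
`∑ i ∈ s, (a_i - 1)` is the top degree if the quotient is level. -/
theorem sum_eq_of_isTopDegree [Finite V] {G : SimpleGraph V} {a : V → ℕ} (ha : ∀ i, 2 ≤ a i) {e : ℕ}
    (he : IsTopDegree (edgeIdeal K G ⊔ powerIdeal K a) e)
    (hsoc : ∀ d, d < e → socleVector (edgeIdeal K G ⊔ powerIdeal K a) d = 0)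
    {s : Finset V} (hind : ∀ i ∈ s, ∀ j ∈ s, ¬ G.Adj i j) (hdom : ∀ x ∉ s, ∃ i ∈ s, G.Adj x i) :
    ∑ i ∈ s, (a i - 1) = e := by
  classical
  set J := edgeIdeal K G ⊔ powerIdeal K a with hJ
  have := finite_quotient_edgeIdeal_sup_powerIdeal (K := K) G a
  let d : V →₀ ℕ := Finsupp.onFinset s (fun i => if i ∈ s then a i - 1 else 0)
    fun i hi => by_contra fun h => hi (if_neg h)
  have hd : ∀ i, d i = if i ∈ s then a i - 1 else 0 := fun i => rfl
  have hdeg : d.degree = ∑ i ∈ s, (a i - 1) := by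
    rw [Finsupp.degree_apply, Finset.sum_subset (s₂ := s) Finsupp.support_onFinset_subset fun i _ hi =>
      Finsupp.notMem_support_iff.1 hi]
    exact Finset.sum_congr rfl fun i hi => by rw [hd, if_pos hi]
  have hnot : monomial d (1 : K) ∉ J := by
    rw [hJ, monomial_mem_edgeIdeal_sup_powerIdeal_iff]
    rintro (⟨i, j, h, hi, hj⟩ | ⟨i, hi⟩)
    · rw [hd] at hi hj
      split_ifs at hi hj with h1 h2
      · exact hind i h1 j h2 h
      all_goals omega
    · rw [hd] at hi
      have := ha i
      split_ifs at hi <;> omega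
  have hsocle : Ideal.Quotient.mk J (monomial d (1 : K)) ∈ socle J := by
    intro i
    rw [← map_mul, Ideal.Quotient.eq_zero_iff_mem, X, monomial_mul, one_mul, hJ,
      monomial_mem_edgeIdeal_sup_powerIdeal_iff]
    by_cases hi : i ∈ s
    · right
      refine ⟨i, ?_⟩
      rw [Finsupp.add_apply, hd, if_pos hi, Finsupp.single_eq_same]
      omega
    · left
      obtain ⟨j, hj, hij⟩ := hdom i hi
      refine ⟨i, j, hij, by simp, ?_⟩
      rw [Finsupp.add_apply, hd, if_pos hj]
      have := ha j
      omega
  have hpiece : Ideal.Quotient.mk J (monomial d (1 : K)) ∈ gradedPiece J d.degree :=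
    ⟨monomial d 1, isHomogeneous_monomial _ rfl, rfl⟩
  have hne : Ideal.Quotient.mk J (monomial d (1 : K)) ≠ 0 := by
    rwa [Ne, Ideal.Quotient.eq_zero_iff_mem]
  rw [← hdeg]
  rcases lt_trichotomy d.degree e with hlt | heq | hgt
  · have h0 := hsoc _ hlt
    -- `finrank` is also `0` in infinite dimension; finiteness of the quotient is what makes this
    -- socle piece trivial.
    rw [socleVector, Submodule.finrank_eq_zero] at h0
    have hmem : Ideal.Quotient.mk J (monomial d (1 : K)) ∈
        gradedPiece J d.degree ⊓ (socle J).restrictScalars K := ⟨hpiece, hsocle⟩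
    rw [h0] at hmem
    exact absurd hmem hne
  · exact heq
  · have := he.2 _ hgt
    rw [this] at hpiece
    exact absurd hpiece hne

/-- If the graph `G` contains an induced path on five vertices together with an independent set that
has no edges to the path and dominates all other vertices, then no artinian quotient is level. -/
theorem not_isLevel_of_induced_path [Finite V] {G : SimpleGraph V} {a : V → ℕ} (ha : ∀ i, 2 ≤ a i)
    {ι : Type*} [Fintype ι] {v : Fin 5 ⊕ ι → V} (hv : Function.Injective v)
    (hG : G.comap v = SimpleGraph.pathGraph 5 ⊕g (⊥ : SimpleGraph ι))
    (hdom : ∀ x, x ∉ Set.range v → ∃ i : ι, G.Adj x (v (Sum.inr i))) :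
    ¬ IsLevel (edgeIdeal K G ⊔ powerIdeal K a) := by
  classical
  rintro ⟨-, e, he, hsoc, -⟩
  have hadj : ∀ x y, G.Adj (v x) (v y) ↔
      (SimpleGraph.pathGraph 5 ⊕g (⊥ : SimpleGraph ι)).Adj x y := fun x y => by
    rw [← hG, SimpleGraph.comap_adj]
  -- A maximal independent set of the path, enlarged by the isolated part, is maximal independent in
  -- `G`.
  have key : ∀ I : Finset (Fin 5), (∀ i ∈ I, ∀ j ∈ I, ¬ (SimpleGraph.pathGraph 5).Adj i j) →
      (∀ i ∉ I, ∃ j ∈ I, (SimpleGraph.pathGraph 5).Adj i j) →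
      ∑ i ∈ I, (a (v (Sum.inl i)) - 1) + ∑ i : ι, (a (v (Sum.inr i)) - 1) = e := by
    intro I hI hI'
    rw [← sum_eq_of_isTopDegree ha he hsoc (s := (I.disjSum Finset.univ).map ⟨v, hv⟩),
      Finset.sum_map, Finset.sum_disjSum]
    · rfl
    · simp only [Finset.mem_map, Function.Embedding.coeFn_mk, forall_exists_index, and_imp]
      rintro _ x hx rfl _ y hy rfl
      rw [hadj]
      rcases x with x | x <;> rcases y with y | y <;> simp_all
    · intro x hx
      by_cases hxr : x ∈ Set.range v
      · obtain ⟨y, rfl⟩ := hxr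
        rcases y with y | y
        · have hy : y ∉ I := fun h => hx (Finset.mem_map_of_mem _ (by simpa using h))
          obtain ⟨j, hj, hyj⟩ := hI' y hy
          exact ⟨v (Sum.inl j), Finset.mem_map_of_mem _ (by simpa using hj),
            (hadj _ _).2 (by simpa using hyj)⟩
        · exact absurd (Finset.mem_map_of_mem _ (by simp)) hx
      · obtain ⟨i, hi⟩ := hdom x hxr
        exact ⟨_, Finset.mem_map_of_mem _ (by simp), hi⟩
  have h1 := key {0, 2, 4} (by simp [SimpleGraph.pathGraph_adj]) (by
    simp only [SimpleGraph.pathGraph_adj]; decide)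
  have h2 := key {1, 3} (by simp [SimpleGraph.pathGraph_adj]) (by
    simp only [SimpleGraph.pathGraph_adj]; decide)
  have h3 := key {0, 3} (by simp [SimpleGraph.pathGraph_adj]) (by
    simp only [SimpleGraph.pathGraph_adj]; decide)
  have h4 := key {1, 4} (by simp [SimpleGraph.pathGraph_adj]) (by
    simp only [SimpleGraph.pathGraph_adj]; decide)
  simp at h1 h2 h3 h4
  -- The four equations make the weight at the middle vertex zero, against `a ≥ 2` there.
  have := ha (v (Sum.inl 2))
  omega

end Algebra

/-! ### Independence of edges in the binomial random graph -/

section RandomGraph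

open MeasureTheory ProbabilityTheory SimpleGraph

variable {V : Type*} (p : unitInterval)

/-- For finite `V` this makes every set of graphs measurable. -/
theorem measurableSingletonClass_simpleGraph [Countable V] :
    MeasurableSingletonClass (SimpleGraph V) where
  measurableSet_singleton G := by
    have h : ({G} : Set (SimpleGraph V)) = edgeSet ⁻¹' {G.edgeSet} := by
      ext G'; simp
    rw [h]
    exact measurable_edgeSet (MeasurableSet.singleton _)

/-- The probability that `G(V, p)` has prescribed adjacencies on a finite set `F` of pairs. -/
theorem binomialRandom_real_prescribed [Finite V] (F : Finset (Sym2 V))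
    (hF : ∀ e ∈ F, ¬ e.IsDiag) (T : Set (Sym2 V)) [DecidablePred (· ∈ T)] :
    (binomialRandom V p).real {G | ∀ e ∈ F, (e ∈ G.edgeSet ↔ e ∈ T)} =
      ∏ e ∈ F, if e ∈ T then (p : ℝ) else 1 - p := by
  have := measurableSingletonClass_simpleGraph (V := V)
  have hpi : (fun q : Sym2 V → Prop => {i | q i}) ⁻¹'
      (fromEdgeSet ⁻¹' {G : SimpleGraph V | ∀ e ∈ F, (e ∈ G.edgeSet ↔ e ∈ T)}) =
      Set.pi F fun e => {e ∈ T} := by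
    ext q
    simp only [Set.mem_preimage, Set.mem_ofPred_eq, edgeSet_fromEdgeSet, Set.mem_pi,
      Set.mem_singleton_iff, Finset.mem_coe]
    refine forall₂_congr fun e he => ?_
    simp [hF e he]
  rw [measureReal_def, binomialRandom_eq_map, Measure.map_apply measurable_fromEdgeSet (.of_discrete),
    setBernoulli_apply', hpi, Measure.infinitePi_pi _ (fun _ _ => .of_discrete), ENNReal.toReal_prod]
  refine Finset.prod_congr rfl fun e he => ?_
  by_cases heT : e ∈ T <;> simp [heT, hF e he]

end RandomGraph

/-! ### Second moment method with defects -/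

section SecondMoment

open MeasureTheory

/-- A second moment bound: if the events `A t` have almost uncorrelated normalized indicators, and
each `A t` is unlikely to be accompanied by the defect `D t`, then it is unlikely that every
occurring `A t` is defective. -/
theorem measureReal_forall_imp_le {Ω ι : Type*} [MeasurableSpace Ω] {μ : Measure Ω}
    [IsProbabilityMeasure μ] [Fintype ι] [Nonempty ι] {A D : ι → Set Ω}
    (hA : ∀ t, MeasurableSet (A t)) (hD : ∀ t, MeasurableSet (D t))
    (hpos : ∀ t, 0 < μ.real (A t)) {δ ε : ℝ}
    (hδ : ∑ t, ∑ t', μ.real (A t ∩ A t') / (μ.real (A t) * μ.real (A t')) ≤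
      (Fintype.card ι : ℝ) ^ 2 * (1 + δ))
    (hε : ∀ t, μ.real (A t ∩ D t) ≤ ε * μ.real (A t)) :
    μ.real {ω | ∀ t, ω ∈ A t → ω ∈ D t} ≤ 2 * ε + 4 * δ := by
  classical
  set N : ℝ := (Fintype.card ι : ℝ) with hN
  have hN0 : 0 < N := by simp [hN, Fintype.card_pos]
  -- `Y` averages the indicators of the `A t`, each scaled to mean `1`; `Z` keeps only the defective
  -- occurrences.
  let Y : Ω → ℝ := fun ω => ∑ t, (A t).indicator (fun _ => (N * μ.real (A t))⁻¹) ω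
  let Z : Ω → ℝ := fun ω => ∑ t, (A t ∩ D t).indicator (fun _ => (N * μ.real (A t))⁻¹) ω
  have hc0 : ∀ t, 0 ≤ (N * μ.real (A t))⁻¹ := fun t => by have := hpos t; positivity
  have hYint : Integrable Y μ :=
    integrable_finsetSum _ fun t _ => (integrable_const _).indicator (hA t)
  have hZint : Integrable Z μ :=
    integrable_finsetSum _ fun t _ => (integrable_const _).indicator ((hA t).inter (hD t))
  have hYY : ∀ ω, Y ω ^ 2 = ∑ t, ∑ t', (A t ∩ A t').indicator
      (fun _ => (N * μ.real (A t))⁻¹ * (N * μ.real (A t'))⁻¹) ω := by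
    intro ω
    rw [sq, Finset.sum_mul_sum]
    refine Finset.sum_congr rfl fun t _ => Finset.sum_congr rfl fun t' _ => ?_
    by_cases h1 : ω ∈ A t <;> by_cases h2 : ω ∈ A t' <;> simp [Set.indicator, h1, h2]
  have hYYint' : Integrable (fun ω => ∑ t, ∑ t', (A t ∩ A t').indicator
      (fun _ => (N * μ.real (A t))⁻¹ * (N * μ.real (A t'))⁻¹) ω) μ :=
    integrable_finsetSum _ fun t _ => integrable_finsetSum _ fun t' _ =>
      (integrable_const _).indicator ((hA t).inter (hA t'))
  have hYYint : Integrable (fun ω => Y ω ^ 2) μ := by simpa only [hYY] using hYYint'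
  have hEY : ∫ ω, Y ω ∂μ = 1 := by
    rw [integral_finsetSum _ fun t _ => (integrable_const _).indicator (hA t)]
    have : ∀ t, ∫ ω, (A t).indicator (fun _ => (N * μ.real (A t))⁻¹) ω ∂μ = N⁻¹ := fun t => by
      rw [integral_indicator_const _ (hA t), smul_eq_mul]
      have := (hpos t).ne'
      field_simp
    rw [Finset.sum_congr rfl fun t _ => this t, Finset.sum_const, Finset.card_univ, nsmul_eq_mul,
      ← hN, mul_inv_cancel₀ hN0.ne']
  have hEZ : ∫ ω, Z ω ∂μ ≤ ε := by
    rw [integral_finsetSum _ fun t _ => (integrable_const _).indicator ((hA t).inter (hD t))]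
    have : ∀ t, ∫ ω, (A t ∩ D t).indicator (fun _ => (N * μ.real (A t))⁻¹) ω ∂μ ≤ ε * N⁻¹ := by
      intro t
      rw [integral_indicator_const _ ((hA t).inter (hD t)), smul_eq_mul]
      refine (mul_le_mul_of_nonneg_right (hε t) (hc0 t)).trans_eq ?_
      have := (hpos t).ne'
      field_simp
    refine (Finset.sum_le_sum fun t _ => this t).trans_eq ?_
    rw [Finset.sum_const, Finset.card_univ, nsmul_eq_mul, ← hN]
    field_simp
  have hEYY : ∫ ω, Y ω ^ 2 ∂μ ≤ 1 + δ := by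
    simp only [hYY]
    rw [integral_finsetSum _ fun t _ => integrable_finsetSum _ fun t' _ =>
      (integrable_const _).indicator ((hA t).inter (hA t'))]
    have : ∀ t, ∫ ω, ∑ t', (A t ∩ A t').indicator
        (fun _ => (N * μ.real (A t))⁻¹ * (N * μ.real (A t'))⁻¹) ω ∂μ =
        ∑ t', μ.real (A t ∩ A t') / (μ.real (A t) * μ.real (A t')) / N ^ 2 := by
      intro t
      rw [integral_finsetSum _ fun t' _ => (integrable_const _).indicator ((hA t).inter (hA t'))]
      refine Finset.sum_congr rfl fun t' _ => ?_
      rw [integral_indicator_const _ ((hA t).inter (hA t')), smul_eq_mul]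
      have h1 := (hpos t).ne'
      have h2 := (hpos t').ne'
      field_simp
    rw [Finset.sum_congr rfl fun t _ => this t]
    simp only [← Finset.sum_div]
    rw [div_le_iff₀ (by positivity), mul_comm]
    exact hδ
  have hmeas : MeasurableSet {ω | ∀ t, ω ∈ A t → ω ∈ D t} := by
    have : {ω | ∀ t, ω ∈ A t → ω ∈ D t} = ⋂ t, (A t)ᶜ ∪ D t := by
      ext ω; simp [imp_iff_not_or]
    rw [this]
    exact MeasurableSet.iInter fun t => (hA t).compl.union (hD t)
  -- On the bad event `Y = Z`, and `1 ≤ 2 Y + 4 (Y - 1) ^ 2` for every real `Y`: either `Y` is large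
  -- or it is far from its mean `1`.
  have hpoint : ∀ ω, {ω | ∀ t, ω ∈ A t → ω ∈ D t}.indicator (fun _ => (1 : ℝ)) ω ≤
      2 * Z ω + 4 * (Y ω ^ 2 - 2 * Y ω + 1) := by
    intro ω
    have hZ0 : 0 ≤ Z ω := Finset.sum_nonneg fun t _ => Set.indicator_nonneg (fun _ _ => hc0 t) ω
    by_cases hω : ω ∈ {ω | ∀ t, ω ∈ A t → ω ∈ D t}
    · have hYZ : Y ω = Z ω := by
        refine Finset.sum_congr rfl fun t _ => ?_
        by_cases h : ω ∈ A t
        · have := hω t h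
          simp [Set.indicator, h, this]
        · simp [Set.indicator, h]
      rw [Set.indicator_of_mem hω, ← hYZ]
      nlinarith [sq_nonneg (4 * Y ω - 3)]
    · rw [Set.indicator_of_notMem hω]
      nlinarith [sq_nonneg (Y ω - 1)]
  calc μ.real {ω | ∀ t, ω ∈ A t → ω ∈ D t}
      = ∫ ω, {ω | ∀ t, ω ∈ A t → ω ∈ D t}.indicator (fun _ => (1 : ℝ)) ω ∂μ := by
        rw [integral_indicator_const _ hmeas, smul_eq_mul, mul_one]
    _ ≤ ∫ ω, (2 * Z ω + 4 * (Y ω ^ 2 - 2 * Y ω + 1)) ∂μ := by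
        refine integral_mono ((integrable_const _).indicator hmeas) ?_ hpoint
        fun_prop
    _ = 2 * ∫ ω, Z ω ∂μ + 4 * (∫ ω, Y ω ^ 2 ∂μ - 2 * ∫ ω, Y ω ∂μ + 1) := by
        rw [integral_add (by fun_prop) (by fun_prop), integral_const_mul, integral_const_mul,
          integral_add (by fun_prop) (by fun_prop), integral_sub (by fun_prop) (by fun_prop),
          integral_const_mul]
        simp
    _ ≤ 2 * ε + 4 * δ := by rw [hEY]; linarith

end SecondMoment

/-! ### Pairs of vertices -/

section Pairs

variable {V : Type*} [DecidableEq V]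

/-- The set of unordered pairs of distinct elements of `s`. -/
def pairs (s : Finset V) : Finset (Sym2 V) := {e ∈ s.sym2 | ¬ e.IsDiag}

theorem mem_pairs {s : Finset V} {e : Sym2 V} : e ∈ pairs s ↔ (∀ x ∈ e, x ∈ s) ∧ ¬ e.IsDiag := by
  simp [pairs, Finset.mem_sym2_iff]

theorem pairs_inter (s t : Finset V) : pairs s ∩ pairs t = pairs (s ∩ t) := by
  ext e
  simp only [Finset.mem_inter, mem_pairs]
  grind

theorem card_pairs (s : Finset V) : (pairs s).card = s.card.choose 2 := by
  rw [← Sym2.card_image_offDiag]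
  congr 1
  ext e
  induction e using Sym2.ind with
  | _ x y =>
    simp only [mem_pairs, Finset.mem_image, Finset.mem_offDiag, Prod.exists]
    simp
    grind

end Pairs

/-! ### Induced copies on transversals of disjoint blocks -/

section Transversals

open MeasureTheory ProbabilityTheory SimpleGraph

variable {V J α : Type*}

/-- The choice of one vertex in each block of a family of disjoint blocks. -/
def transversal (ι : J × α ↪ V) (t : J → α) : J ↪ V :=
  ⟨fun i => ι (i, t i), fun _ _ h => congrArg Prod.fst (ι.injective h)⟩

theorem transversal_apply (ι : J × α ↪ V) (t : J → α) (i : J) : transversal ι t i = ι (i, t i) := rfl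

/-- The graph on `V` in which the blocks are joined completely according to `H`. -/
def blowup (ι : J × α ↪ V) (H : SimpleGraph J) : SimpleGraph V := (H.comap Prod.fst).map ι

theorem blowup_adj_transversal (ι : J × α ↪ V) (H : SimpleGraph J) (t : J → α) (i j : J) :
    (blowup ι H).Adj (transversal ι t i) (transversal ι t j) ↔ H.Adj i j := by
  rw [transversal_apply, transversal_apply, blowup, map_adj_apply, comap_adj]

theorem not_blowup_adj_of_isolated (ι : J × α ↪ V) (H : SimpleGraph J) (t : J → α) {i : J}
    (hi : ∀ j, ¬ H.Adj i j) (x : V) : ¬ (blowup ι H).Adj x (transversal ι t i) := by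
  rintro ⟨-, ⟨a, _⟩, ⟨b, _⟩, h, -, h2⟩
  have : b = i := congrArg Prod.fst (ι.injective h2)
  subst this
  exact hi _ h.symm

variable [Fintype J] [DecidableEq V]

/-- Blocks are disjoint, so a common vertex lies in a single block, where the two choices agree. -/
theorem card_transversal_inter_le [DecidableEq α] (ι : J × α ↪ V) (t t' : J → α) :
    (Finset.univ.map (transversal ι t) ∩ Finset.univ.map (transversal ι t')).card ≤
      (Finset.univ.filter fun i => t i = t' i).card := by
  refine (Finset.card_le_card ?_).trans (Finset.card_map (transversal ι t)).le
  intro x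
  simp only [Finset.mem_inter, Finset.mem_map, Finset.mem_univ, true_and, Finset.mem_filter,
    transversal_apply]
  rintro ⟨⟨i, rfl⟩, ⟨j, hj⟩⟩
  have h := ι.injective hj
  rw [Prod.mk.injEq] at h
  obtain ⟨rfl, h2⟩ := h
  exact ⟨j, h2.symm, rfl⟩

/-- The event that the transversal `t` induces a copy of `H`. -/
def inducedCopy (ι : J × α ↪ V) (H : SimpleGraph J) (t : J → α) : Set (SimpleGraph V) :=
  {G | ∀ e ∈ pairs (Finset.univ.map (transversal ι t)), e ∈ G.edgeSet ↔ e ∈ (blowup ι H).edgeSet}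

/-- The event that some vertex off the transversal `t` has no neighbour in its `S`-part. -/
def undominated (ι : J × α ↪ V) (S : Finset J) (t : J → α) : Set (SimpleGraph V) :=
  {G | ∃ x, x ∉ Set.range (transversal ι t) ∧ ∀ i ∈ S, ¬ G.Adj x (transversal ι t i)}

theorem comap_eq_of_mem_inducedCopy {ι : J × α ↪ V} {H : SimpleGraph J} {t : J → α}
    {G : SimpleGraph V} (hG : G ∈ inducedCopy ι H t) : G.comap (transversal ι t) = H := by
  ext i j
  rw [comap_adj]
  by_cases hij : i = j
  · simp [hij]
  · rw [← blowup_adj_transversal ι H t, ← mem_edgeSet, ← mem_edgeSet]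
    refine hG _ (mem_pairs.2 ⟨?_, ?_⟩)
    · intro x hx
      rcases Sym2.mem_iff.1 hx with rfl | rfl <;> simp
    · simpa using hij

open scoped Classical in
theorem card_pairs_filter_blowup_le (ι : J × α ↪ V) (H : SimpleGraph J) (t : J → α) :
    ((pairs (Finset.univ.map (transversal ι t))).filter (· ∈ (blowup ι H).edgeSet)).card ≤
      H.edgeFinset.card := by
  refine (Finset.card_le_card (t := H.edgeFinset.image (Sym2.map (transversal ι t))) ?_).trans
    Finset.card_image_le
  intro e
  induction e using Sym2.ind with
  | _ x y =>
    rw [Finset.mem_filter, mem_pairs]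
    rintro ⟨⟨h, -⟩, h'⟩
    obtain ⟨i, -, rfl⟩ := Finset.mem_map.1 (h x (Sym2.mem_mk_left _ _))
    obtain ⟨j, -, rfl⟩ := Finset.mem_map.1 (h y (Sym2.mem_mk_right _ _))
    rw [mem_edgeSet, blowup_adj_transversal] at h'
    exact Finset.mem_image.2 ⟨s(i, j), by simpa using h', rfl⟩

variable [Fintype V] {p : unitInterval}

open scoped Classical in
theorem binomialRandom_real_inducedCopy (ι : J × α ↪ V) (H : SimpleGraph J) (t : J → α) :
    (binomialRandom V p).real (inducedCopy ι H t) =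
      ∏ e ∈ pairs (Finset.univ.map (transversal ι t)),
        if e ∈ (blowup ι H).edgeSet then (p : ℝ) else 1 - p :=
  binomialRandom_real_prescribed p _ (fun _ he => (mem_pairs.1 he).2) _

theorem binomialRandom_real_inducedCopy_pos (hp0 : 0 < p) (hp1 : p < 1) (ι : J × α ↪ V)
    (H : SimpleGraph J) (t : J → α) : 0 < (binomialRandom V p).real (inducedCopy ι H t) := by
  classical
  rw [binomialRandom_real_inducedCopy]
  have h0 : (0 : ℝ) < p := hp0
  have h1 : (p : ℝ) < 1 := hp1
  refine Finset.prod_pos fun e _ => ?_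
  split_ifs
  · exact h0
  · linarith

-- Both events prescribe the edges of the same blowup, so they are compatible and their correlation
-- is the inverse probability of the pairs counted twice. If the transversals agree in `l` blocks,
-- there are at most `l.choose 2 ≤ h * l` such pairs. Bounding the correlation by a product over
-- blocks lets the sum over `t'` factorise later.
open scoped Classical in
theorem binomialRandom_real_inducedCopy_inter_le (hp0 : 0 < p) (hp1 : p < 1) (ι : J × α ↪ V)
    (H : SimpleGraph J) (t t' : J → α) {h : ℕ} (hJ : Fintype.card J ≤ 2 * h + 1) :
    (binomialRandom V p).real (inducedCopy ι H t ∩ inducedCopy ι H t') ≤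
      (binomialRandom V p).real (inducedCopy ι H t) *
        (binomialRandom V p).real (inducedCopy ι H t') *
        ∏ i, if t i = t' i then ((1 - (p : ℝ)) ^ h * (p : ℝ) ^ H.edgeFinset.card)⁻¹ else 1 := by
  have h0 : (0 : ℝ) < p := hp0
  have h1 : (p : ℝ) < 1 := hp1
  have hq : 0 < 1 - (p : ℝ) := by linarith
  set π : Sym2 V → ℝ := fun e => if e ∈ (blowup ι H).edgeSet then (p : ℝ) else 1 - p with hπ
  set F := pairs (Finset.univ.map (transversal ι t)) with hF
  set F' := pairs (Finset.univ.map (transversal ι t')) with hF'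
  set l := (Finset.univ.filter fun i => t i = t' i).card with hl
  set c : ℝ := (1 - (p : ℝ)) ^ h * (p : ℝ) ^ H.edgeFinset.card with hc
  have hc0 : 0 < c := by positivity
  have hπ0 : ∀ e, 0 < π e := fun e => by rw [hπ]; dsimp only; split_ifs <;> assumption
  have hunion : inducedCopy ι H t ∩ inducedCopy ι H t' =
      {G | ∀ e ∈ F ∪ F', e ∈ G.edgeSet ↔ e ∈ (blowup ι H).edgeSet} := by
    ext G
    simp only [inducedCopy, Set.mem_inter_iff, Set.mem_ofPred_eq, Finset.mem_union]
    exact ⟨fun hG e he => he.elim (hG.1 e) (hG.2 e),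
      fun hG => ⟨fun e he => hG e (.inl he), fun e he => hG e (.inr he)⟩⟩
  have hP : (binomialRandom V p).real (inducedCopy ι H t ∩ inducedCopy ι H t') =
      ∏ e ∈ F ∪ F', π e := by
    rw [hunion]
    refine binomialRandom_real_prescribed p (F ∪ F') (fun e he => ?_) (blowup ι H).edgeSet
    rcases Finset.mem_union.1 he with he | he <;> exact (mem_pairs.1 he).2
  have hcard : (F ∩ F').card ≤ l.choose 2 := by
    rw [hF, hF', pairs_inter, card_pairs]
    exact Nat.choose_le_choose 2 (card_transversal_inter_le ι t t')
  have hlow : c ^ l ≤ ∏ e ∈ F ∩ F', π e := by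
    -- Disjoint transversals share no pair. For `l ≥ 1` the edges of `H` are paid for by `p ^
    -- |E(H)|` once, hence also by its `l`-th power.
    rcases Nat.eq_zero_or_pos l with hl0 | hlpos
    · have : F ∩ F' = ∅ := by
        rw [← Finset.card_eq_zero]; simpa [hl0] using hcard
      rw [this, hl0]; simp
    · have hlJ : l ≤ 2 * h + 1 := (Finset.card_le_univ _).trans hJ
      have hlh : l.choose 2 ≤ h * l := by
        rw [Nat.choose_two_right]
        refine Nat.div_le_of_le_mul ?_
        calc l * (l - 1) ≤ l * (2 * h) := Nat.mul_le_mul_left _ (by omega)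
          _ = 2 * (h * l) := by ring
      -- Charging `1 - p` to every pair and a further `p` to each edge separates the two counts.
      have hpt : ∀ e ∈ F ∩ F', (1 - (p : ℝ)) * (if e ∈ (blowup ι H).edgeSet then (p : ℝ) else 1) ≤
          π e := by
        intro e _
        rw [hπ]
        dsimp only
        split_ifs
        · nlinarith
        · rw [mul_one]
      refine le_trans ?_ (Finset.prod_le_prod (fun e _ => ?_) hpt)
      · rw [Finset.prod_mul_distrib, Finset.prod_const, Finset.prod_ite, Finset.prod_const,
          Finset.prod_const_one, mul_one, hc, mul_pow, ← pow_mul, ← pow_mul]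
        refine mul_le_mul ?_ ?_ (by positivity) (by positivity)
        · exact pow_le_pow_of_le_one hq.le (by linarith) (hcard.trans hlh)
        · refine pow_le_pow_of_le_one h0.le h1.le ?_
          refine le_trans ((Finset.card_le_card ?_).trans (card_pairs_filter_blowup_le ι H t))
            (Nat.le_mul_of_pos_right _ hlpos)
          exact Finset.filter_subset_filter _ Finset.inter_subset_left
      · split_ifs <;> nlinarith
  have hprod : ∏ i, (if t i = t' i then c⁻¹ else 1) = (c ^ l)⁻¹ := by
    rw [Finset.prod_ite, Finset.prod_const, Finset.prod_const_one, mul_one, inv_pow]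
  rw [hprod, hP, binomialRandom_real_inducedCopy, binomialRandom_real_inducedCopy,
    ← Finset.prod_union_inter, mul_assoc]
  refine le_mul_of_one_le_right (Finset.prod_pos fun e _ => hπ0 e).le ?_
  rw [← div_eq_mul_inv, one_le_div (by positivity)]
  exact hlow

/-- For a vertex `x` off the transversal, the pairs joining `x` to `S` are disjoint from the pairs
inside it, so non-domination of `x` is independent of the copy and costs `(1 - p) ^ S.card`. A union
bound over `x` finishes. -/
theorem binomialRandom_real_inducedCopy_inter_undominated_le (hp0 : 0 < p) (hp1 : p < 1)
    (ι : J × α ↪ V) (H : SimpleGraph J) {S : Finset J} (hS : ∀ i ∈ S, ∀ j, ¬ H.Adj i j)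
    (t : J → α) :
    (binomialRandom V p).real (inducedCopy ι H t ∩ undominated ι S t) ≤
      Fintype.card V * (1 - (p : ℝ)) ^ S.card *
        (binomialRandom V p).real (inducedCopy ι H t) := by
  classical
  have h0 : (0 : ℝ) < p := hp0
  have h1 : (p : ℝ) < 1 := hp1
  set F := pairs (Finset.univ.map (transversal ι t)) with hF
  let Q : V → Finset (Sym2 V) := fun x => S.image fun i => s(x, transversal ι t i)
  let X : Finset V := Finset.univ.filter fun x => x ∉ Set.range (transversal ι t)
  -- Vertices of `S` are isolated in `H`, so the blowup already prescribes these pairs as non-edges.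
  have hQT : ∀ x, ∀ e ∈ Q x, e ∉ (blowup ι H).edgeSet := by
    intro x e he
    obtain ⟨i, hi, rfl⟩ := Finset.mem_image.1 he
    exact not_blowup_adj_of_isolated ι H t (hS i hi) x
  have hsub : inducedCopy ι H t ∩ undominated ι S t ⊆
      ⋃ x ∈ X, {G | ∀ e ∈ F ∪ Q x, e ∈ G.edgeSet ↔ e ∈ (blowup ι H).edgeSet} := by
    rintro G ⟨hG, x, hx, hGx⟩
    simp only [Set.mem_iUnion, exists_prop]
    refine ⟨x, by simpa [X] using hx, fun e he => ?_⟩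
    rcases Finset.mem_union.1 he with he | he
    · exact hG e he
    · refine iff_of_false ?_ (hQT x e he)
      obtain ⟨i, hi, rfl⟩ := Finset.mem_image.1 he
      exact hGx i hi
  have hx : ∀ x ∈ X, (binomialRandom V p).real
      {G | ∀ e ∈ F ∪ Q x, e ∈ G.edgeSet ↔ e ∈ (blowup ι H).edgeSet} =
      (1 - (p : ℝ)) ^ S.card * (binomialRandom V p).real (inducedCopy ι H t) := by
    intro x hx
    have hxr : ∀ i, transversal ι t i ≠ x := by simpa [X] using hx
    rw [binomialRandom_real_prescribed p, binomialRandom_real_inducedCopy, Finset.prod_union,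
      mul_comm]
    · congr 1
      rw [Finset.prod_congr (g := fun _ => 1 - (p : ℝ)) rfl fun e he => if_neg (hQT x e he), Finset.prod_const,
        Finset.card_image_of_injective]
      intro i j hij
      exact (transversal ι t).injective (Sym2.congr_right.1 hij)
    · rw [Finset.disjoint_left]
      intro e he heQ
      obtain ⟨i, hi, rfl⟩ := Finset.mem_image.1 heQ
      obtain ⟨j, -, hj⟩ := Finset.mem_map.1 ((mem_pairs.1 he).1 x (Sym2.mem_mk_left _ _))
      exact hxr j hj
    · intro e he
      rcases Finset.mem_union.1 he with he | he
      · exact (mem_pairs.1 he).2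
      · obtain ⟨i, hi, rfl⟩ := Finset.mem_image.1 he
        simpa using (hxr i).symm
  calc (binomialRandom V p).real (inducedCopy ι H t ∩ undominated ι S t)
      ≤ (binomialRandom V p).real
        (⋃ x ∈ X, {G | ∀ e ∈ F ∪ Q x, e ∈ G.edgeSet ↔ e ∈ (blowup ι H).edgeSet}) :=
        measureReal_mono hsub (measure_ne_top _ _)
    _ ≤ ∑ x ∈ X, (binomialRandom V p).real
        {G | ∀ e ∈ F ∪ Q x, e ∈ G.edgeSet ↔ e ∈ (blowup ι H).edgeSet} :=
        measureReal_biUnion_finset_le _ _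
    _ = X.card * ((1 - (p : ℝ)) ^ S.card * (binomialRandom V p).real (inducedCopy ι H t)) := by
        rw [Finset.sum_congr rfl hx, Finset.sum_const, nsmul_eq_mul]
    _ ≤ _ := by
        rw [mul_assoc]
        refine mul_le_mul_of_nonneg_right (by exact_mod_cast Finset.card_le_univ X) ?_
        have : 0 ≤ 1 - (p : ℝ) := by linarith
        positivity

open scoped Classical in
/-- With high probability, some transversal induces a copy of `H` whose isolated part `S` dominates
all vertices outside it. -/
theorem binomialRandom_real_no_dominating_copy_le [Fintype α] [Nonempty α]
    (hp0 : 0 < p) (hp1 : p < 1) (ι : J × α ↪ V) (H : SimpleGraph J) {S : Finset J}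
    (hS : ∀ i ∈ S, ∀ j, ¬ H.Adj i j) {h : ℕ} (hJ : Fintype.card J ≤ 2 * h + 1) :
    (binomialRandom V p).real {G | ∀ t, G ∈ inducedCopy ι H t → G ∈ undominated ι S t} ≤
      2 * (Fintype.card V * (1 - (p : ℝ)) ^ S.card) +
        4 * ((1 + ((1 - (p : ℝ)) ^ h * (p : ℝ) ^ H.edgeFinset.card)⁻¹ / Fintype.card α) ^
          Fintype.card J - 1) := by
  have := measurableSingletonClass_simpleGraph (V := V)
  have h0 : (0 : ℝ) < p := hp0
  have h1 : (p : ℝ) < 1 := hp1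
  have hq : 0 < 1 - (p : ℝ) := by linarith
  have hpos := binomialRandom_real_inducedCopy_pos hp0 hp1 ι H
  refine measureReal_forall_imp_le (fun _ => .of_discrete) (fun _ => .of_discrete) hpos ?_
    (binomialRandom_real_inducedCopy_inter_undominated_le hp0 hp1 ι H hS)
  set c : ℝ := (1 - (p : ℝ)) ^ h * (p : ℝ) ^ H.edgeFinset.card with hc
  have hc0 : 0 < c := by positivity
  have hm : (0 : ℝ) < Fintype.card α := by simp [Fintype.card_pos]
  -- The sum over `t'` is a product over blocks: in each, one value of `t' i` contributes `c⁻¹` and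
  -- the others `1`.
  have hrow : ∀ t : J → α, ∑ t' : J → α, ∏ i, (if t i = t' i then c⁻¹ else 1) ≤
      (Fintype.card α * (1 + c⁻¹ / Fintype.card α)) ^ Fintype.card J := by
    intro t
    have hsum := Finset.prod_univ_sum (fun _ : J => (Finset.univ : Finset α))
      (fun i b => if t i = b then c⁻¹ else (1 : ℝ))
    rw [Fintype.piFinset_univ] at hsum
    rw [← hsum, ← Finset.card_univ (α := J), ← Finset.prod_const]
    refine Finset.prod_le_prod (fun i _ => Finset.sum_nonneg fun b _ => ?_) fun i _ => ?_
    · split_ifs <;> positivity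
    · calc ∑ b : α, (if t i = b then c⁻¹ else (1 : ℝ))
          ≤ ∑ b : α, (1 + if t i = b then c⁻¹ else 0) := by
            refine Finset.sum_le_sum fun b _ => ?_
            split_ifs <;> linarith
        _ = Fintype.card α * (1 + c⁻¹ / Fintype.card α) := by
            rw [Finset.sum_add_distrib, Finset.sum_ite_eq]
            simp
            field_simp
  calc _ ≤ ∑ t : J → α, ∑ t' : J → α, ∏ i, (if t i = t' i then c⁻¹ else 1) := by
        refine Finset.sum_le_sum fun t _ => Finset.sum_le_sum fun t' _ => ?_
        rw [div_le_iff₀ (mul_pos (hpos t) (hpos t')), mul_comm]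
        exact binomialRandom_real_inducedCopy_inter_le hp0 hp1 ι H t t' hJ
    _ ≤ ∑ t : J → α, (Fintype.card α * (1 + c⁻¹ / Fintype.card α)) ^ Fintype.card J :=
        Finset.sum_le_sum fun t _ => hrow t
    _ = _ := by
        rw [Finset.sum_const, Finset.card_univ, Fintype.card_fun, nsmul_eq_mul, mul_pow]
        push_cast
        ring

end Transversals

/-! ### Choice of the size of the independent set -/

section Asymptotics

open Filter Topology

/-- For `h ≈ (3/4) log_{1/q} n`, independent sets of size about `2 h` dominate all vertices, while
`h` is still in the range of the second moment method. -/
theorem exists_tendsto_mul_pow {q : ℝ} (hq0 : 0 < q) (hq1 : q < 1) :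
    ∃ h : ℕ → ℕ, (∀ᶠ n in atTop, 2 ≤ h n) ∧
      Tendsto (fun n : ℕ => (n : ℝ) * q ^ (2 * h n - 4)) atTop (𝓝 0) ∧
      Tendsto (fun n : ℕ => (2 * (h n : ℝ) + 1) ^ 2 / (n * q ^ h n)) atTop (𝓝 0) := by
  set L : ℝ := -Real.log q with hL
  have hL0 : 0 < L := neg_pos.2 (Real.log_neg hq0 hq1)
  have hpow : ∀ k : ℕ, q ^ k = Real.exp (-(L * k)) := fun k => by
    rw [hL, neg_mul, neg_neg, mul_comm, Real.exp_nat_mul, Real.exp_log hq0]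
  set c : ℝ := 3 / (4 * L) with hc
  have hc0 : 0 < c := by positivity
  have hcL : L * c = 3 / 4 := by rw [hc]; field_simp
  have hlog : Tendsto (fun n : ℕ => Real.log n) atTop atTop :=
    Real.tendsto_log_atTop.comp tendsto_natCast_atTop_atTop
  have hrpow : ∀ s : ℝ, 0 < s → Tendsto (fun n : ℕ => (n : ℝ) ^ (-s)) atTop (𝓝 0) := fun s hs =>
    (tendsto_rpow_neg_atTop hs).comp tendsto_natCast_atTop_atTop
  have hexp : ∀ (s : ℝ) {n : ℕ}, 1 ≤ n → Real.exp (s * Real.log n) = (n : ℝ) ^ s := by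
    intro s n hn
    rw [Real.rpow_def_of_pos (by exact_mod_cast hn), mul_comm]
  -- Here `q ^ h` is about `n ^ (-3/4)`, so the two quantities have orders `n ^ (-1/2)` and `(log n)
  -- ^ 2 * n ^ (-1/4)`.
  refine ⟨fun n => ⌊c * Real.log n⌋₊, ?_, ?_, ?_⟩
  · filter_upwards [(hlog.const_mul_atTop hc0).eventually_ge_atTop 2] with n hn
    exact Nat.le_floor (by exact_mod_cast hn)
  · have hlim : Tendsto (fun n : ℕ => (q ^ 6)⁻¹ * (n : ℝ) ^ (-(1 / 2) : ℝ)) atTop (𝓝 0) := by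
      simpa using (hrpow (1 / 2) (by norm_num)).const_mul (q ^ 6)⁻¹
    refine tendsto_of_tendsto_of_tendsto_of_le_of_le' tendsto_const_nhds hlim
      (Eventually.of_forall fun n => by positivity) ?_
    filter_upwards [(hlog.const_mul_atTop hc0).eventually_ge_atTop 2, eventually_ge_atTop 1]
      with n hn hn1
    set h := ⌊c * Real.log n⌋₊ with hh
    have hh2 : 2 ≤ h := Nat.le_floor (by exact_mod_cast hn)
    have hn0 : (0 : ℝ) < n := by exact_mod_cast hn1
    have h1 : q ^ (h + 1) ≤ (n : ℝ) ^ (-(3 / 4) : ℝ) := by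
      rw [hpow, ← hexp _ hn1, Real.exp_le_exp]
      have := (Nat.lt_floor_add_one (c * Real.log n)).le
      have h2 := mul_le_mul_of_nonneg_left this hL0.le
      rw [← mul_assoc, hcL, ← hh] at h2
      push_cast
      linarith
    -- The floor gives an upper bound only for `q ^ (h + 1)`; since `2h - 4 = 2(h + 1) - 6`, the
    -- loss is the constant `q ^ (-6)`.
    have h3 : q ^ (2 * h - 4) = (q ^ 6)⁻¹ * (q ^ (h + 1) * q ^ (h + 1)) := by
      rw [eq_inv_mul_iff_mul_eq₀ (by positivity), ← pow_add, ← pow_add]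
      congr 1
      omega
    rw [h3]
    calc (n : ℝ) * ((q ^ 6)⁻¹ * (q ^ (h + 1) * q ^ (h + 1)))
        ≤ n * ((q ^ 6)⁻¹ * ((n : ℝ) ^ (-(3 / 4) : ℝ) * (n : ℝ) ^ (-(3 / 4) : ℝ))) := by gcongr
      _ = (q ^ 6)⁻¹ * ((n : ℝ) ^ (1 : ℝ) * ((n : ℝ) ^ (-(3 / 4) : ℝ) * (n : ℝ) ^ (-(3 / 4) : ℝ))) := by
        rw [Real.rpow_one]; ring
      _ = (q ^ 6)⁻¹ * (n : ℝ) ^ (-(1 / 2) : ℝ) := by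
        rw [← Real.rpow_add hn0, ← Real.rpow_add hn0]; norm_num
  · have hlim : Tendsto (fun n : ℕ =>
        ((2 * (c * Real.log n) + 1) * (n : ℝ) ^ (-(1 / 8) : ℝ)) ^ 2) atTop (𝓝 0) := by
      have h1 : Tendsto (fun n : ℕ => Real.log n * (n : ℝ) ^ (-(1 / 8) : ℝ)) atTop (𝓝 0) := by
        have h2 := ((isLittleO_log_rpow_atTop (r := 1 / 8) (by norm_num)).tendsto_div_nhds_zero).comp
          tendsto_natCast_atTop_atTop
        refine h2.congr fun n => ?_
        simp only [Function.comp_apply]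
        rw [Real.rpow_neg (Nat.cast_nonneg n), div_eq_mul_inv]
      have h3 := ((h1.const_mul (2 * c)).add (hrpow (1 / 8) (by norm_num))).pow 2
      simp only [mul_zero, add_zero, ne_eq, OfNat.ofNat_ne_zero, not_false_eq_true, zero_pow] at h3
      refine h3.congr fun n => ?_
      ring
    refine tendsto_of_tendsto_of_tendsto_of_le_of_le' tendsto_const_nhds hlim
      (Eventually.of_forall fun n => by positivity) ?_
    filter_upwards [eventually_ge_atTop 1] with n hn1
    set h := ⌊c * Real.log n⌋₊ with hh
    have hn0 : (0 : ℝ) < n := by exact_mod_cast hn1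
    have hfl : (h : ℝ) ≤ c * Real.log n :=
      Nat.floor_le (mul_nonneg hc0.le (Real.log_nonneg (by exact_mod_cast hn1)))
    have h1 : (n : ℝ) ^ (-(3 / 4) : ℝ) ≤ q ^ h := by
      rw [hpow, ← hexp _ hn1, Real.exp_le_exp]
      have h2 := mul_le_mul_of_nonneg_left hfl hL0.le
      rw [← mul_assoc, hcL] at h2
      linarith
    have h2 : (n : ℝ) ^ (1 / 4 : ℝ) ≤ n * q ^ h := by
      calc (n : ℝ) ^ (1 / 4 : ℝ) = (n : ℝ) ^ (1 : ℝ) * (n : ℝ) ^ (-(3 / 4) : ℝ) := by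
            rw [← Real.rpow_add hn0]; norm_num
        _ ≤ n * q ^ h := by rw [Real.rpow_one]; gcongr
    calc (2 * (h : ℝ) + 1) ^ 2 / (n * q ^ h)
        ≤ (2 * (c * Real.log n) + 1) ^ 2 / (n : ℝ) ^ (1 / 4 : ℝ) := by gcongr
      _ = ((2 * (c * Real.log n) + 1) * (n : ℝ) ^ (-(1 / 8) : ℝ)) ^ 2 := by
        rw [mul_pow, ← Real.rpow_natCast ((n : ℝ) ^ (-(1 / 8) : ℝ)), ← Real.rpow_mul hn0.le,
          div_eq_mul_inv, ← Real.rpow_neg hn0.le]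
        norm_num

end Asymptotics

/-! ### Assembling the bound -/

section Main

open Filter Topology SimpleGraph MeasureTheory

-- The isolated part adds no edges, so the factor `p ^ |E(H)|` does not depend on `n`.
open scoped Classical in
theorem card_edgeFinset_pathGraph_sum_bot (ι : Type*) [Fintype ι] :
    (pathGraph 5 ⊕g (⊥ : SimpleGraph ι)).edgeFinset.card = (pathGraph 5).edgeSet.ncard := by
  rw [← coe_edgeFinset (pathGraph 5), Set.ncard_coe_finset,
    ← Finset.card_image_of_injective (pathGraph 5).edgeFinset
    (Sym2.map.injective (Sum.inl_injective (β := ι)))]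
  congr 1
  ext e
  induction e using Sym2.ind with
  | _ x y =>
    rw [mem_edgeFinset, mem_edgeSet, Finset.mem_image]
    constructor
    · rcases x with x | x <;> rcases y with y | y
      · intro h
        exact ⟨s(x, y), by simpa using h, rfl⟩
      all_goals simp
    · rintro ⟨e, he, hxy⟩
      induction e using Sym2.ind with
      | _ a b =>
        rw [mem_edgeFinset, mem_edgeSet] at he
        rw [← mem_edgeSet, ← hxy, Sym2.map_mk, mem_edgeSet]
        simpa using he

/-- An explicit bound for the probability that some artinian quotient by the edge ideal of `G(n, p)`
and pure powers of the variables is level. -/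
theorem binomialRandom_real_exists_isLevel_le (K : Type*) [Field K] {p : unitInterval} (hp0 : 0 < p)
    (hp1 : p < 1) {n h : ℕ} (hh : 2 ≤ h) (hn : 2 * (2 * h + 1) ≤ n) :
    (binomialRandom (Fin n) p).real {G : SimpleGraph (Fin n) | ∀ a : Fin n → ℕ, (∀ i, 2 ≤ a i) →
      IsGradedArtinian (edgeIdeal K G ⊔ powerIdeal K a) ∧
      ¬ IsLevel (edgeIdeal K G ⊔ powerIdeal K a)}ᶜ ≤
      2 * (n * (1 - (p : ℝ)) ^ (2 * h - 4)) +
        4 * (Real.exp (2 * ((p : ℝ) ^ (pathGraph 5).edgeSet.ncard)⁻¹ *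
          ((2 * (h : ℝ) + 1) ^ 2 / (n * (1 - (p : ℝ)) ^ h))) - 1) := by
  classical
  set m := n / (2 * h + 1) with hm
  have hm2 : 2 ≤ m := (Nat.le_div_iff_mul_le (by omega)).2 hn
  have : Nonempty (Fin m) := ⟨⟨0, by omega⟩⟩
  have hJ : Fintype.card (Fin 5 ⊕ Fin (2 * h - 4)) = 2 * h + 1 := by
    simp only [Fintype.card_sum, Fintype.card_fin]; omega
  obtain ⟨ι⟩ : Nonempty ((Fin 5 ⊕ Fin (2 * h - 4)) × Fin m ↪ Fin n) := by
    refine Function.Embedding.nonempty_of_card_le ?_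
    rw [Fintype.card_prod, hJ, Fintype.card_fin, Fintype.card_fin]
    exact Nat.mul_div_le n _
  let S : Finset (Fin 5 ⊕ Fin (2 * h - 4)) := Finset.univ.map Function.Embedding.inr
  have hS : ∀ i ∈ S, ∀ j, ¬ (pathGraph 5 ⊕g (⊥ : SimpleGraph (Fin (2 * h - 4)))).Adj i j := by
    intro i hi j
    obtain ⟨k, -, rfl⟩ := Finset.mem_map.1 hi
    cases j <;> simp
  have hScard : S.card = 2 * h - 4 := by simp [S]
  have key := binomialRandom_real_no_dominating_copy_le hp0 hp1 ι
    (pathGraph 5 ⊕g (⊥ : SimpleGraph (Fin (2 * h - 4)))) hS hJ.le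
  rw [hScard, hJ, card_edgeFinset_pathGraph_sum_bot, Fintype.card_fin, Fintype.card_fin] at key
  refine (measureReal_mono ?_ (measure_ne_top _ _)).trans (key.trans ?_)
  · intro G hG t hGt
    by_contra hdom
    refine hG fun a ha => ⟨isGradedArtinian_edgeIdeal_sup_powerIdeal G a, ?_⟩
    refine not_isLevel_of_induced_path ha (transversal ι t).injective
      (comap_eq_of_mem_inducedCopy hGt) fun x hx => ?_
    by_contra hx'
    refine hdom ⟨x, hx, fun i hi => ?_⟩
    obtain ⟨k, -, rfl⟩ := Finset.mem_map.1 hi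
    exact fun h => hx' ⟨k, h⟩
  · have h0 : (0 : ℝ) < p := hp0
    have h1 : (p : ℝ) < 1 := hp1
    have hq : 0 < 1 - (p : ℝ) := by linarith
    have hn0 : (0 : ℝ) < n := by exact_mod_cast (by omega : 0 < n)
    -- Rounding the block size down loses at most a factor `2`.
    have hmn : (m : ℝ)⁻¹ ≤ 2 * (2 * h + 1) / n := by
      have hm0 : (0 : ℝ) < m := by exact_mod_cast (by omega : 0 < m)
      rw [inv_le_iff_one_le_mul₀ hm0, div_mul_eq_mul_div, one_le_div hn0]
      have h3 : n < (m + 1) * (2 * h + 1) := by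
        have := Nat.lt_div_mul_add (a := n) (b := 2 * h + 1) (by omega)
        rw [← hm] at this
        linarith
      have h4 : n ≤ 2 * (2 * h + 1) * m := by nlinarith
      exact_mod_cast h4
    gcongr
    set P : ℝ := (p : ℝ) ^ (pathGraph 5).edgeSet.ncard with hP
    have hP0 : 0 < P := by positivity
    calc (1 + ((1 - (p : ℝ)) ^ h * P)⁻¹ / m) ^ (2 * h + 1)
        ≤ (Real.exp (((1 - (p : ℝ)) ^ h * P)⁻¹ / m)) ^ (2 * h + 1) := by
          gcongr
          rw [add_comm]
          exact Real.add_one_le_exp _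
      _ = Real.exp ((2 * h + 1) * (((1 - (p : ℝ)) ^ h * P)⁻¹ * (m : ℝ)⁻¹)) := by
          rw [← Real.exp_nat_mul, div_eq_mul_inv]; push_cast; rfl
      _ ≤ Real.exp ((2 * h + 1) * (((1 - (p : ℝ)) ^ h * P)⁻¹ * (2 * (2 * h + 1) / n))) := by
          gcongr
      _ = _ := by
          congr 1
          field_simp

end Main

end LevelGraph

open Filter Topology MeasureTheory in
theorem mainTheorem8 (K : Type*) [Field K] (p : unitInterval) (hp0 : 0 < p) (hp1 : p < 1) :
    Filter.Tendsto
      (fun n : ℕ => SimpleGraph.binomialRandom (Fin n) p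
        {G : SimpleGraph (Fin n) | ∀ a : Fin n → ℕ, (∀ i, 2 ≤ a i) →
          LevelGraph.IsGradedArtinian (LevelGraph.edgeIdeal K G ⊔ LevelGraph.powerIdeal K a) ∧
          ¬ LevelGraph.IsLevel (LevelGraph.edgeIdeal K G ⊔ LevelGraph.powerIdeal K a)})
      Filter.atTop (nhds 1) := by
  have h0 : (0 : ℝ) < p := hp0
  have h1 : (p : ℝ) < 1 := hp1
  obtain ⟨h, hh2, hdom, hmom⟩ :=
    LevelGraph.exists_tendsto_mul_pow (q := 1 - (p : ℝ)) (by linarith) (by linarith)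
  have hbound := (hdom.const_mul 2).add ((((hmom.const_mul (2 * ((p : ℝ) ^
    (SimpleGraph.pathGraph 5).edgeSet.ncard)⁻¹)).rexp).sub_const 1).const_mul 4)
  simp only [mul_zero, Real.exp_zero, sub_self, add_zero] at hbound
  -- Once the moment ratio is below `1 / 2`, `2 (2h + 1) ^ 2 ≤ n q ^ h ≤ n`, so the blocks have at
  -- least two vertices.
  have hlarge : ∀ᶠ n : ℕ in atTop, 2 * (2 * h n + 1) ≤ n := by
    filter_upwards [hmom.eventually_lt_const (u := 1 / 2) (by norm_num), eventually_ge_atTop 1]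
      with n hn hn1
    have hn0 : (0 : ℝ) < n := by exact_mod_cast hn1
    have hq : 0 < 1 - (p : ℝ) := by linarith
    have hpow : (1 - (p : ℝ)) ^ h n ≤ 1 := pow_le_one₀ hq.le (by linarith)
    rw [div_lt_iff₀ (by positivity)] at hn
    have h2 : (n : ℝ) * (1 - (p : ℝ)) ^ h n ≤ n := mul_le_of_le_one_right hn0.le hpow
    have h3 : (2 : ℝ) * (2 * h n + 1) ≤ n := by nlinarith [(h n).cast_nonneg (α := ℝ)]
    exact_mod_cast h3
  have hcompl : Tendsto (fun n : ℕ => (SimpleGraph.binomialRandom (Fin n) p).real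
      {G : SimpleGraph (Fin n) | ∀ a : Fin n → ℕ, (∀ i, 2 ≤ a i) →
        LevelGraph.IsGradedArtinian (LevelGraph.edgeIdeal K G ⊔ LevelGraph.powerIdeal K a) ∧
        ¬ LevelGraph.IsLevel (LevelGraph.edgeIdeal K G ⊔ LevelGraph.powerIdeal K a)}ᶜ)
      atTop (𝓝 0) := by
    refine tendsto_of_tendsto_of_tendsto_of_le_of_le' tendsto_const_nhds hbound
      (Eventually.of_forall fun n => measureReal_nonneg) ?_
    filter_upwards [hh2, hlarge] with n hn2 hn
    exact LevelGraph.binomialRandom_real_exists_isLevel_le K hp0 hp1 hn2 hn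
  have hreal := hcompl.const_sub 1
  rw [sub_zero] at hreal
  have hENN := ENNReal.tendsto_ofReal hreal
  rw [ENNReal.ofReal_one] at hENN
  refine hENN.congr fun n => ?_
  have := LevelGraph.measurableSingletonClass_simpleGraph (V := Fin n)
  rw [probReal_compl_eq_one_sub .of_discrete, sub_sub_cancel, ofReal_measureReal]
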